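/- Consider a system of $k=k_F+k_S$ servers, $k_F\ge 1$ of them fast with exponential service times of rate $\mu_F$, and $k_S\ge 1$ of them slow with exponential service times of rate $\mu_S$, where $\mu_F>\mu_S>0$. Put $q_F=k_F/k$ and $q_S=k_S/k$, and assume $\mu_Fq_F+\mu_Sq_S=1$. Jobs arrive as a Poisson process of rate $\lambda k$. Let $1\le d_F\le k_F$, $1\le d_S\le k_S$ and $p_F,p_S\in[0,1]$. On arrival, a job queries $d_F$ fast and $d_S$ slow servers, chosen uniformly at random without replacement, and is dispatched at once to a queried server. If some queried fast server is idle, the job goes to a uniformly random idle queried fast server. If all queried fast servers are busy but some queried slow server is idle, the job goes with probability $p_S$ to a uniformly random idle queried slow server and with probability $1-p_S$ to a chosen queried fast server. If all queried servers are busy, the job goes with probability $p_F$ to a chosen queried fast server and with probability $1-p_F$ to a chosen queried slow server. Under the policy JIQ-$(d_F,d_S)$ the chosen server is uniformly random among the queried servers of the class; under JSQ-$(d_F,d_S)$ it is one with the fewest jobs among them, ties being broken uniformly at random. The numbers of jobs at the $k$ servers form a continuous-time Markov chain; the system is called stable if this chain has a stationary probability distribution (equivalently, if the empty state is positive recurrent),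 and unstable otherwise. **Theorem 2.** Under each of the two policies, for fixed $k_F,k_S,d_F,d_S,\mu_F,\mu_S$ and $p_F$: 1. If $p_F=\mu_Fq_F$ and $p_S\ge\mu_Sq_S$, then the system is stable for every $\lambda\in(0,1)$, hence in particular as $\lambda\to1$. 2. If $p_F\ne\mu_Fq_F$, then there is $\lambda_0<1$ such that for every $\lambda\in(\lambda_0,1)$ and every $p_S\in[0,1]$ the system is unstable. 3. Hence $p_F=\mu_Fq_F$ is the only stable choice as the load approaches capacity: there is $p_S\in[0,1]$ such that the system is stable for all $\lambda<1$ close enough to $1$ if and only if $p_F=\mu_Fq_F$. -/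

import Mathlib

open Filter Topology

namespace Dispatch

/-- The two dispatching policies; they differ in how a busy server is chosen. -/
inductive Policy
  | JIQ
  | JSQ

/-- A system: `kF` fast servers with service rate `muF`, `kS` slow servers with service rate `muS`,
`dF` fast and `dS` slow servers queried by each arriving job, routing probabilities `pF`, `pS`,
and Poisson arrivals with rate `lam * (kF + kS)`. -/
structure Params where
  policy : Policy
  kF : ℕ
  kS : ℕ
  dF : ℕ
  dS : ℕ
  muF : ℝ
  muS : ℝ
  pF : ℝ
  pS : ℝ
  lam : ℝ

noncomputable section

/-- Mass at `i` of the uniform distribution on the finite set `C`. -/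
def unif {ι : Type} [DecidableEq ι] (C : Finset ι) (i : ι) : ℝ :=
  if i ∈ C then 1 / (C.card : ℝ) else 0

/-- The idle servers (no jobs) among those in `A`. -/
def idle {ι : Type} (A : Finset ι) (x : ι → ℕ) : Finset ι :=
  A.filter (fun i => x i = 0)

/-- The candidates for the "chosen" server among the queried (busy) servers `A` when the numbers of
jobs are `x`; the chosen server is uniform on this set. Under JIQ all servers in `A` are candidates,
under JSQ those with the fewest jobs. -/
def candidates {ι : Type} (pol : Policy) (A : Finset ι) (x : ι → ℕ) : Finset ι :=
  match pol with
  | Policy.JIQ => A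
  | Policy.JSQ => A.filter (fun i => ∀ j ∈ A, x i ≤ x j)

namespace Params

variable (P : Params)

/-- Servers: `Sum.inl i` is the `i`-th fast server and `Sum.inr j` the `j`-th slow server. -/
abbrev Server : Type := Fin P.kF ⊕ Fin P.kS

/-- A state gives the number of jobs at each server, including the job in service. -/
abbrev State : Type := P.Server → ℕ

/-- The service rate of a server. -/
def mu : P.Server → ℝ
  | Sum.inl _ => P.muF
  | Sum.inr _ => P.muS

/-- Probability that a job that arrives in state `x` and queries the fast servers `A` and the slow
servers `B` is dispatched to server `s`. -/
def dispatchProb (x : P.State) (A : Finset (Fin P.kF)) (B : Finset (Fin P.kS)) :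
    P.Server → ℝ
  | Sum.inl i =>
      if (idle A (fun a => x (Sum.inl a))).Nonempty then
        unif (idle A (fun a => x (Sum.inl a))) i
      else if (idle B (fun b => x (Sum.inr b))).Nonempty then
        (1 - P.pS) * unif (candidates P.policy A (fun a => x (Sum.inl a))) i
      else
        P.pF * unif (candidates P.policy A (fun a => x (Sum.inl a))) i
  | Sum.inr j =>
      if (idle A (fun a => x (Sum.inl a))).Nonempty then
        0
      else if (idle B (fun b => x (Sum.inr b))).Nonempty then
        P.pS * unif (idle B (fun b => x (Sum.inr b))) j
      else
        (1 - P.pF) * unif (candidates P.policy B (fun b => x (Sum.inr b))) j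

/-- Probability that a job that arrives in state `x` is dispatched to server `s`, the `dF` fast and
`dS` slow servers to query being drawn uniformly at random without replacement. -/
def routeProb (x : P.State) (s : P.Server) : ℝ :=
  (∑ A ∈ Finset.powersetCard P.dF (Finset.univ : Finset (Fin P.kF)),
    ∑ B ∈ Finset.powersetCard P.dS (Finset.univ : Finset (Fin P.kS)),
      P.dispatchProb x A B s) / ((P.kF.choose P.dF : ℝ) * (P.kS.choose P.dS : ℝ))

/-- Rate at which jobs arrive at server `s` in state `x`. -/
def arrivalRate (x : P.State) (s : P.Server) : ℝ :=
  P.lam * ((P.kF : ℝ) + (P.kS : ℝ)) * P.routeProb x s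

/-- State `x` with one more job at server `s`. -/
def addJob (x : P.State) (s : P.Server) : P.State := Function.update x s (x s + 1)

/-- State `x` with one job fewer at server `s` (used only when `s` is busy). -/
def removeJob (x : P.State) (s : P.Server) : P.State := Function.update x s (x s - 1)

/-- Generator (`Q`-matrix) of the continuous-time Markov chain of the numbers of jobs: in state `x`,
each server `s` receives a job at rate `arrivalRate x s` and, if it is busy, completes a job at rate
`mu s`. Each transition `x → x'` with rate `r` adds `r` to `Q x x'` and `-r` to `Q x x`. -/
def Q (x y : P.State) : ℝ :=
  (∑ s, P.arrivalRate x s *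
      ((if y = P.addJob x s then 1 else 0) - (if y = x then 1 else 0))) +
  ∑ s, if 0 < x s then
      P.mu s * ((if y = P.removeJob x s then 1 else 0) - (if y = x then 1 else 0))
    else 0

/-- `p` is a stationary probability distribution of the chain: a probability distribution that
satisfies the global balance equations `p Q = 0`. -/
def IsStationary (p : P.State → ℝ) : Prop :=
  (∀ x, 0 ≤ p x) ∧ HasSum p 1 ∧ ∀ y, HasSum (fun x => p x * P.Q x y) 0

/-- The system is stable if its Markov chain has a stationary probability distribution. All jump
rates are bounded (so the chain does not explode) and the empty state can be reached from every
state, so this says that the empty state is positive recurrent. -/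
def Stable : Prop := ∃ p : P.State → ℝ, P.IsStationary p

end Params

end

end Dispatch

/-! Write `K = kF + kS`, so that capacity one per server means `∑ mu = K`.

Stability: use the Lyapunov function `V x = ∑ (x s)^2`. Up to a constant its drift is twice `lam *
K` times the mean queue length met by an arrival, minus twice `∑ mu s * x s`. Idle servers
contribute no length, and JIQ and JSQ choose a server no longer on average than the queried ones.
Hence, if `1 - pS ≤ pF`, the mean length met is at most `pF` times the fast mean plus `1 - pF` times
the slow mean (`sum_routeProb_mul_le`). For `pF = muF * qF` this bound, multiplied by `K`, is
exactly `∑ mu s * x s`, leaving drift at most `totalRate - 2 (1 - lam) ∑ mu s * x s`. Foster's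
criterion (`stable_of_drift`) concludes: Cesàro means of the uniformised chain are tight, and their
limit is stationary.

Instability: in stationarity, flow balance over all servers makes the mean idle capacity `(1 - lam)
* K` (`hasSum_idle`), so some server is idle with probability at most `(1 - lam) * K / muS`.
Otherwise the fast class receives the share `pF` of arrivals and the slow class `1 - pF`. Flow
balance of one class (`le_capacity_of_stationary`) then gives, as `lam → 1`, `K * pF ≤ muF * kF` and
`K * (1 - pF) ≤ muS * kS`. The two sides have equal totals, so any `pF ≠ muF * qF` violates one of
them strictly, already for `lam` near 1 and uniformly in `pS`. -/

namespace Dispatch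

/-! ### Uniform choices and random subsets -/

section Choice

variable {ι : Type}

lemma unif_nonneg [DecidableEq ι] (C : Finset ι) (i : ι) : 0 ≤ unif C i := by
  unfold unif; split_ifs <;> positivity

lemma sum_unif_mul [Fintype ι] [DecidableEq ι] (C : Finset ι) (f : ι → ℝ) :
    ∑ i, unif C i * f i = (∑ i ∈ C, f i) / C.card := by
  simp [unif, ite_mul, Finset.mul_sum, div_eq_inv_mul]

lemma sum_unif [Fintype ι] [DecidableEq ι] {C : Finset ι} (hC : C.Nonempty) : ∑ i, unif C i = 1 := by
  have h := sum_unif_mul C (fun _ => (1 : ℝ))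
  have hC' : (C.card : ℝ) ≠ 0 := by exact_mod_cast hC.card_pos.ne'
  simpa [hC'] using h

lemma candidates_nonempty (pol : Policy) {A : Finset ι} (hA : A.Nonempty) (x : ι → ℕ) :
    (candidates pol A x).Nonempty := by
  cases pol with
  | JIQ => exact hA
  | JSQ =>
    obtain ⟨i, hi, hmin⟩ := A.exists_min_image x hA
    exact ⟨i, Finset.mem_filter.2 ⟨hi, hmin⟩⟩

lemma sum_unif_idle_mul [Fintype ι] [DecidableEq ι] (A : Finset ι) (x : ι → ℕ) :
    ∑ i, unif (idle A x) i * (x i : ℝ) = 0 := by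
  rw [sum_unif_mul, Finset.sum_eq_zero, zero_div]
  intro i hi
  simp [(Finset.mem_filter.1 hi).2]

/-- The expected queue length at the chosen server is at most the mean over the queried servers. -/
lemma sum_unif_candidates_mul_le [Fintype ι] [DecidableEq ι] (pol : Policy) {A : Finset ι} (hA : A.Nonempty)
    (x : ι → ℕ) :
    ∑ i, unif (candidates pol A x) i * (x i : ℝ) ≤ (∑ i ∈ A, (x i : ℝ)) / A.card := by
  have hA' : (0 : ℝ) < A.card := by exact_mod_cast hA.card_pos
  cases pol with
  | JIQ => rw [sum_unif_mul]; rfl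
  | JSQ =>
    obtain ⟨m, hm, hmin⟩ := A.exists_min_image x hA
    -- All JSQ candidates have the minimal length, that of `m`, and a minimum is at most the mean.
    have hle : ∑ i, unif (candidates Policy.JSQ A x) i * (x i : ℝ) ≤ x m := by
      have hC := candidates_nonempty Policy.JSQ hA x
      calc ∑ i, unif (candidates Policy.JSQ A x) i * (x i : ℝ)
          ≤ ∑ i, unif (candidates Policy.JSQ A x) i * (x m : ℝ) := by
            refine Finset.sum_le_sum fun i _ => ?_
            by_cases hi : i ∈ candidates Policy.JSQ A x
            · have hi' : i ∈ A ∧ ∀ j ∈ A, x i ≤ x j := by simpa [candidates] using hi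
              have := hi'.2 m hm
              exact mul_le_mul_of_nonneg_left (by exact_mod_cast this) (unif_nonneg _ _)
            · simp [unif, hi]
        _ = x m := by rw [← Finset.sum_mul, sum_unif hC, one_mul]
    refine hle.trans ?_
    rw [le_div_iff₀ hA', mul_comm, ← nsmul_eq_mul]
    exact Finset.card_nsmul_le_sum _ _ _ fun i hi => by exact_mod_cast hmin i hi

/-- Averaging the mean over a uniformly random `d`-subset gives the overall mean. -/
lemma sum_powersetCard_mean [Fintype ι] [DecidableEq ι] {d : ℕ} (hd : 1 ≤ d) (hdk : d ≤ Fintype.card ι)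
    (f : ι → ℝ) :
    ∑ A ∈ Finset.powersetCard d (Finset.univ : Finset ι), (∑ i ∈ A, f i) / d
      = ((Fintype.card ι).choose d : ℝ) * ((∑ i, f i) / Fintype.card ι) := by
  have hd' : (d : ℝ) ≠ 0 := by positivity
  have hk' : (Fintype.card ι : ℝ) ≠ 0 := by
    have : 0 < Fintype.card ι := by omega
    positivity
  -- By symmetry each `i` lies in the fraction `d / k` of the `d`-subsets, from `k * C(k-1, d-1) =
  -- C(k, d) * d`.
  have hcount (i : ι) : (((Finset.powersetCard d (Finset.univ : Finset ι)).filter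
      (fun A => i ∈ A)).card : ℝ) = (Fintype.card ι).choose d * d / Fintype.card ι := by
    have h := Finset.card_filter_powersetCard_subset {i} (Finset.univ : Finset ι) d
      (Finset.subset_univ _)
    simp only [Finset.singleton_subset_iff, Finset.card_singleton, Finset.card_univ] at h
    rw [h (by simpa using hd), eq_div_iff hk']
    have := Nat.add_one_mul_choose_eq (Fintype.card ι - 1) (d - 1)
    rw [Nat.sub_add_cancel (by omega), Nat.sub_add_cancel hd] at this
    rw [mul_comm]
    exact_mod_cast this
  rw [← Finset.sum_div]
  have hswap : ∑ A ∈ Finset.powersetCard d (Finset.univ : Finset ι), ∑ i ∈ A, f i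
      = ∑ i, ((Fintype.card ι).choose d * d / Fintype.card ι : ℝ) * f i := by
    have : ∀ A ∈ Finset.powersetCard d (Finset.univ : Finset ι),
        ∑ i ∈ A, f i = ∑ i, if i ∈ A then f i else 0 := by
      intro A _; simp
    rw [Finset.sum_congr rfl this, Finset.sum_comm]
    refine Finset.sum_congr rfl fun i _ => ?_
    rw [← Finset.sum_filter, Finset.sum_const, nsmul_eq_mul, hcount]
  rw [hswap, ← Finset.mul_sum]
  field_simp

end Choice

/-! ### Routing probabilities -/

namespace Params

/-- The constraints on the parameters of a system. -/
structure Valid (P : Params) : Prop where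
  one_le_dF : 1 ≤ P.dF
  dF_le : P.dF ≤ P.kF
  one_le_dS : 1 ≤ P.dS
  dS_le : P.dS ≤ P.kS
  muF_pos : 0 < P.muF
  muS_pos : 0 < P.muS
  pF_nonneg : 0 ≤ P.pF
  pF_le_one : P.pF ≤ 1
  pS_nonneg : 0 ≤ P.pS
  pS_le_one : P.pS ≤ 1
  lam_pos : 0 < P.lam

variable {P : Params}

lemma dispatchProb_nonneg (hP : P.Valid) (x : P.State) (A : Finset (Fin P.kF))
    (B : Finset (Fin P.kS)) (s : P.Server) : 0 ≤ P.dispatchProb x A B s := by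
  have h1 := hP.pF_nonneg
  have h2 := sub_nonneg.2 hP.pF_le_one
  have h3 := hP.pS_nonneg
  have h4 := sub_nonneg.2 hP.pS_le_one
  cases s <;> simp only [dispatchProb] <;> split_ifs <;>
    first
      | exact le_rfl
      | exact unif_nonneg _ _
      | exact mul_nonneg (by assumption) (unif_nonneg _ _)

lemma sum_dispatchProb {A : Finset (Fin P.kF)} {B : Finset (Fin P.kS)} (hA : A.Nonempty)
    (hB : B.Nonempty) (x : P.State) : ∑ s, P.dispatchProb x A B s = 1 := by
  rw [Fintype.sum_sum_type]
  simp only [dispatchProb]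
  split_ifs with h1 h2
  · simp [sum_unif h1]
  · rw [← Finset.mul_sum, ← Finset.mul_sum, sum_unif h2,
      sum_unif (candidates_nonempty _ hA _)]
    ring
  · rw [← Finset.mul_sum, ← Finset.mul_sum, sum_unif (candidates_nonempty _ hB _),
      sum_unif (candidates_nonempty _ hA _)]
    ring

/-- A job sent to an idle server meets length 0. So with an idle slow server only the probability `1
- pS` of joining a busy fast one counts, and `hpS` bounds it by `pF`; this is the only place where
`pS` matters. -/
lemma sum_dispatchProb_mul_le (hP : P.Valid) (hpS : 1 - P.pS ≤ P.pF) {A : Finset (Fin P.kF)}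
    {B : Finset (Fin P.kS)} (hA : A.Nonempty) (hB : B.Nonempty) (x : P.State) :
    ∑ s, P.dispatchProb x A B s * (x s : ℝ) ≤
      P.pF * ((∑ i ∈ A, (x (Sum.inl i) : ℝ)) / A.card) +
        (1 - P.pF) * ((∑ j ∈ B, (x (Sum.inr j) : ℝ)) / B.card) := by
  have h1 := hP.pF_nonneg
  have h2 := sub_nonneg.2 hP.pF_le_one
  have hAm : 0 ≤ (∑ i ∈ A, (x (Sum.inl i) : ℝ)) / A.card := by positivity
  have hBm : 0 ≤ (∑ j ∈ B, (x (Sum.inr j) : ℝ)) / B.card := by positivity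
  have hcA := sum_unif_candidates_mul_le P.policy hA (fun a => x (Sum.inl a))
  have hcB := sum_unif_candidates_mul_le P.policy hB (fun b => x (Sum.inr b))
  have hiA := sum_unif_idle_mul A (fun a => x (Sum.inl a))
  have hiB := sum_unif_idle_mul B (fun b => x (Sum.inr b))
  have hc0 : 0 ≤ ∑ i, unif (candidates P.policy A fun a => x (Sum.inl a)) i *
      (x (Sum.inl i) : ℝ) :=
    Finset.sum_nonneg fun i _ => mul_nonneg (unif_nonneg _ _) (Nat.cast_nonneg _)
  rw [Fintype.sum_sum_type]
  simp only [dispatchProb]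
  split_ifs with h3 h4
  · rw [hiA]
    simp only [zero_mul, Finset.sum_const_zero, add_zero]
    positivity
  · simp only [mul_assoc]
    rw [← Finset.mul_sum, ← Finset.mul_sum, hiB]
    have := mul_le_mul_of_nonneg_right hpS hc0
    have := mul_le_mul_of_nonneg_left hcA h1
    have := mul_nonneg h2 hBm
    linarith
  · simp only [mul_assoc]
    rw [← Finset.mul_sum, ← Finset.mul_sum]
    exact add_le_add (mul_le_mul_of_nonneg_left hcA h1) (mul_le_mul_of_nonneg_left hcB h2)

/-- When all servers are busy, the job goes to the fast class with probability `pF`. -/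
lemma sum_dispatchProb_inl {A : Finset (Fin P.kF)} {B : Finset (Fin P.kS)} (hA : A.Nonempty)
    {x : P.State} (hx : ∀ s, 0 < x s) :
    ∑ i, P.dispatchProb x A B (Sum.inl i) = P.pF := by
  have hiA : ¬ (idle A fun a => x (Sum.inl a)).Nonempty := by
    rintro ⟨i, hi⟩; exact (hx _).ne' (Finset.mem_filter.1 hi).2
  have hiB : ¬ (idle B fun b => x (Sum.inr b)).Nonempty := by
    rintro ⟨i, hi⟩; exact (hx _).ne' (Finset.mem_filter.1 hi).2
  simp only [dispatchProb, if_neg hiA, if_neg hiB]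
  rw [← Finset.mul_sum, sum_unif (candidates_nonempty _ hA _), mul_one]

lemma nonempty_of_mem_powersetCard {ι : Type} [Fintype ι] {d : ℕ} (hd : 1 ≤ d) {A : Finset ι}
    (hA : A ∈ Finset.powersetCard d (Finset.univ : Finset ι)) : A.Nonempty := by
  rw [← Finset.card_pos, (Finset.mem_powersetCard.1 hA).2]; omega

lemma choose_mul_choose_pos (hP : P.Valid) :
    (0 : ℝ) < (P.kF.choose P.dF : ℝ) * (P.kS.choose P.dS : ℝ) := by
  have h1 := Nat.choose_pos hP.dF_le
  have h2 := Nat.choose_pos hP.dS_le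
  positivity

lemma routeProb_nonneg (hP : P.Valid) (x : P.State) (s : P.Server) : 0 ≤ P.routeProb x s :=
  div_nonneg (Finset.sum_nonneg fun _ _ => Finset.sum_nonneg fun _ _ =>
    dispatchProb_nonneg hP _ _ _ _) (choose_mul_choose_pos hP).le

lemma sum_routeProb_mul {ι : Type} [Fintype ι] (e : ι → P.Server) (x : P.State) (f : ι → ℝ) :
    ∑ i, P.routeProb x (e i) * f i =
      (∑ A ∈ Finset.powersetCard P.dF (Finset.univ : Finset (Fin P.kF)),
        ∑ B ∈ Finset.powersetCard P.dS (Finset.univ : Finset (Fin P.kS)),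
          ∑ i, P.dispatchProb x A B (e i) * f i) /
            ((P.kF.choose P.dF : ℝ) * (P.kS.choose P.dS : ℝ)) := by
  simp only [routeProb, div_mul_eq_mul_div]
  rw [← Finset.sum_div]
  congr 1
  simp only [Finset.sum_mul]
  rw [Finset.sum_comm]
  refine Finset.sum_congr rfl fun A _ => ?_
  rw [Finset.sum_comm]

lemma sum_routeProb_of_forall (hP : P.Valid) {ι : Type} [Fintype ι] (e : ι → P.Server)
    (x : P.State) (c : ℝ)
    (h : ∀ A B, A.Nonempty → B.Nonempty → ∑ i, P.dispatchProb x A B (e i) = c) :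
    ∑ i, P.routeProb x (e i) = c := by
  have := sum_routeProb_mul e x (fun _ => (1 : ℝ))
  simp only [mul_one] at this
  rw [this, div_eq_iff (choose_mul_choose_pos hP).ne']
  rw [Finset.sum_congr rfl fun A hA => Finset.sum_congr rfl fun B hB =>
    h A B (nonempty_of_mem_powersetCard hP.one_le_dF hA)
      (nonempty_of_mem_powersetCard hP.one_le_dS hB)]
  simp only [Finset.sum_const, Finset.card_powersetCard, Finset.card_univ, Fintype.card_fin,
    nsmul_eq_mul]
  ring

lemma sum_routeProb (hP : P.Valid) (x : P.State) : ∑ s, P.routeProb x s = 1 :=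
  sum_routeProb_of_forall hP id x 1 fun _ _ hA hB => sum_dispatchProb hA hB x

lemma sum_routeProb_inl (hP : P.Valid) {x : P.State} (hx : ∀ s, 0 < x s) :
    ∑ i, P.routeProb x (Sum.inl i) = P.pF :=
  sum_routeProb_of_forall hP Sum.inl x _ fun _ _ hA _ => sum_dispatchProb_inl hA hx

lemma sum_routeProb_inr (hP : P.Valid) {x : P.State} (hx : ∀ s, 0 < x s) :
    ∑ j, P.routeProb x (Sum.inr j) = 1 - P.pF := by
  have h := sum_routeProb hP x
  rw [Fintype.sum_sum_type, sum_routeProb_inl hP hx] at h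
  linarith

lemma sum_routeProb_mul_le (hP : P.Valid) (hpS : 1 - P.pS ≤ P.pF) (x : P.State) :
    ∑ s, P.routeProb x s * (x s : ℝ) ≤
      P.pF * ((∑ i, (x (Sum.inl i) : ℝ)) / P.kF) +
        (1 - P.pF) * ((∑ j, (x (Sum.inr j) : ℝ)) / P.kS) := by
  have h := sum_routeProb_mul id x (fun s => (x s : ℝ))
  simp only [id] at h
  rw [h, div_le_iff₀ (choose_mul_choose_pos hP)]
  calc _ ≤ ∑ A ∈ Finset.powersetCard P.dF (Finset.univ : Finset (Fin P.kF)),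
        ∑ B ∈ Finset.powersetCard P.dS (Finset.univ : Finset (Fin P.kS)),
        (P.pF * ((∑ i ∈ A, (x (Sum.inl i) : ℝ)) / P.dF) +
        (1 - P.pF) * ((∑ j ∈ B, (x (Sum.inr j) : ℝ)) / P.dS)) := by
        refine Finset.sum_le_sum fun A hA => Finset.sum_le_sum fun B hB => ?_
        have := sum_dispatchProb_mul_le hP hpS (nonempty_of_mem_powersetCard hP.one_le_dF hA)
          (nonempty_of_mem_powersetCard hP.one_le_dS hB) x
        rwa [(Finset.mem_powersetCard.1 hA).2, (Finset.mem_powersetCard.1 hB).2] at this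
    _ = _ := by
        have hF := sum_powersetCard_mean (ι := Fin P.kF) hP.one_le_dF
          (by simpa using hP.dF_le) (fun i => (x (Sum.inl i) : ℝ))
        have hS := sum_powersetCard_mean (ι := Fin P.kS) hP.one_le_dS
          (by simpa using hP.dS_le) (fun i => (x (Sum.inr i) : ℝ))
        simp only [Fintype.card_fin] at hF hS
        simp only [Finset.sum_add_distrib, ← Finset.mul_sum, hF, hS, Finset.sum_const,
          Finset.card_powersetCard, Finset.card_univ, Fintype.card_fin, nsmul_eq_mul]
        ring

/-! ### Generator and uniformised chain -/

/-- The generator as an operator on functions of the state. -/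
noncomputable def gen (P : Params) : (P.State → ℝ) →ₗ[ℝ] (P.State → ℝ) where
  toFun g x := (∑ s, P.arrivalRate x s * (g (P.addJob x s) - g x)) +
    ∑ s, if 0 < x s then P.mu s * (g (P.removeJob x s) - g x) else 0
  map_add' g h := by
    funext x
    simp only [Pi.add_apply]
    rw [add_add_add_comm]
    refine congrArg₂ (· + ·) ?_ ?_ <;> rw [← Finset.sum_add_distrib] <;>
      refine Finset.sum_congr rfl fun s _ => ?_
    · ring
    · split_ifs <;> ring
  map_smul' c g := by
    funext x
    simp only [Pi.smul_apply, smul_eq_mul, RingHom.id_apply]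
    rw [mul_add, Finset.mul_sum, Finset.mul_sum]
    congr 1 <;> refine Finset.sum_congr rfl fun s _ => ?_
    · ring
    · split_ifs <;> ring

lemma gen_apply (g : P.State → ℝ) (x : P.State) :
    P.gen g x = (∑ s, P.arrivalRate x s * (g (P.addJob x s) - g x)) +
      ∑ s, if 0 < x s then P.mu s * (g (P.removeJob x s) - g x) else 0 := rfl

/-- The indicator function of the state `y`. -/
noncomputable def point (y : P.State) : P.State → ℝ := fun z => if y = z then 1 else 0

/-- Turns global balance at `y` into vanishing of the stationary mean of `gen (point y)`. It is
definitional because `point` tests `y = z` in the same orientation as `Q`. -/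
lemma Q_eq_gen_point (x y : P.State) : P.Q x y = P.gen (point y) x := rfl

/-- An upper bound for the total jump rate out of any state. -/
noncomputable def totalRate (P : Params) : ℝ := P.lam * ((P.kF : ℝ) + (P.kS : ℝ)) + ∑ s, P.mu s

lemma servers_pos (hP : P.Valid) : (0 : ℝ) < (P.kF : ℝ) + (P.kS : ℝ) := by
  have h1 := hP.one_le_dF
  have h2 := hP.dF_le
  have : 0 < P.kF := by omega
  positivity

lemma mu_pos (hP : P.Valid) : ∀ s, 0 < P.mu s
  | Sum.inl _ => hP.muF_pos
  | Sum.inr _ => hP.muS_pos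

lemma arrivalRate_nonneg (hP : P.Valid) (x : P.State) (s : P.Server) : 0 ≤ P.arrivalRate x s :=
  mul_nonneg (mul_nonneg hP.lam_pos.le (servers_pos hP).le) (routeProb_nonneg hP x s)

lemma sum_arrivalRate (hP : P.Valid) (x : P.State) :
    ∑ s, P.arrivalRate x s = P.lam * ((P.kF : ℝ) + (P.kS : ℝ)) := by
  simp only [arrivalRate]
  rw [← Finset.mul_sum, sum_routeProb hP, mul_one]

lemma totalRate_pos (hP : P.Valid) : 0 < P.totalRate :=
  add_pos_of_pos_of_nonneg (mul_pos hP.lam_pos (servers_pos hP))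
    (Finset.sum_nonneg fun s _ => (mu_pos hP s).le)

lemma gen_const (c : ℝ) : P.gen (fun _ => c) = 0 := by
  funext x; simp [gen_apply]

/-- A nonnegative function decreases at most at rate `totalRate`. -/
lemma neg_totalRate_mul_le_gen (hP : P.Valid) {g : P.State → ℝ} (hg : ∀ x, 0 ≤ g x)
    (x : P.State) : -(P.totalRate * g x) ≤ P.gen g x := by
  have h1 : -(P.lam * ((P.kF : ℝ) + (P.kS : ℝ)) * g x) ≤
      ∑ s, P.arrivalRate x s * (g (P.addJob x s) - g x) := by
    rw [← sum_arrivalRate hP x, Finset.sum_mul, ← Finset.sum_neg_distrib]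
    refine Finset.sum_le_sum fun s _ => ?_
    have := mul_nonneg (arrivalRate_nonneg hP x s) (hg (P.addJob x s))
    linarith
  have h2 : -((∑ s, P.mu s) * g x) ≤
      ∑ s, if 0 < x s then P.mu s * (g (P.removeJob x s) - g x) else 0 := by
    rw [Finset.sum_mul, ← Finset.sum_neg_distrib]
    refine Finset.sum_le_sum fun s _ => ?_
    have h3 := mul_nonneg (mu_pos hP s).le (hg (P.removeJob x s))
    have h4 := mul_nonneg (mu_pos hP s).le (hg x)
    split_ifs <;> linarith
  rw [gen_apply, totalRate]
  linarith

/-- Transition operator of the uniformised discrete-time chain. -/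
noncomputable def step (P : Params) : Module.End ℝ (P.State → ℝ) := 1 + P.totalRate⁻¹ • P.gen

lemma step_apply (g : P.State → ℝ) (x : P.State) :
    P.step g x = g x + P.totalRate⁻¹ * P.gen g x := rfl

/-- `totalRate` dominates the jump rate out of every state, so the holding probability of the
uniformised chain is nonnegative. -/
lemma step_nonneg (hP : P.Valid) {g : P.State → ℝ} (hg : ∀ x, 0 ≤ g x) (x : P.State) :
    0 ≤ P.step g x := by
  have h := mul_le_mul_of_nonneg_left (neg_totalRate_mul_le_gen hP hg x)
    (inv_pos.2 (totalRate_pos hP)).le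
  have h' : P.totalRate⁻¹ * -(P.totalRate * g x) = - g x := by
    have := (totalRate_pos hP).ne'
    field_simp
  rw [step_apply]
  linarith

lemma step_pow_nonneg (hP : P.Valid) {g : P.State → ℝ} (hg : ∀ x, 0 ≤ g x) (n : ℕ)
    (x : P.State) : 0 ≤ (P.step ^ n) g x := by
  induction n generalizing x with
  | zero => exact hg x
  | succ n ih => rw [pow_succ']; exact step_nonneg hP ih x

lemma step_pow_mono (hP : P.Valid) {g h : P.State → ℝ} (hgh : ∀ x, g x ≤ h x) (n : ℕ)
    (x : P.State) : (P.step ^ n) g x ≤ (P.step ^ n) h x := by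
  have := step_pow_nonneg hP (g := h - g) (fun x => sub_nonneg.2 (hgh x)) n x
  rw [map_sub] at this
  exact sub_nonneg.1 this

lemma step_pow_const (n : ℕ) (c : ℝ) (x : P.State) : (P.step ^ n) (fun _ => c) x = c := by
  induction n generalizing x with
  | zero => rfl
  | succ n ih =>
    rw [pow_succ, Module.End.mul_apply]
    have : P.step (fun _ => c) = fun _ => c := by
      funext y; rw [step_apply, gen_const]; simp
    rw [this, ih]

/-! ### Cesàro means and Foster's criterion -/

/-- Mean of `g` over the first `n` steps of the uniformised chain started from the empty state. -/
noncomputable def cesaro (P : Params) (n : ℕ) : (P.State → ℝ) →ₗ[ℝ] ℝ :=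
  (n : ℝ)⁻¹ • ∑ m ∈ Finset.range n, (LinearMap.proj (0 : P.State)).comp (P.step ^ m)

lemma cesaro_apply (n : ℕ) (g : P.State → ℝ) :
    P.cesaro n g = (n : ℝ)⁻¹ * ∑ m ∈ Finset.range n, (P.step ^ m) g 0 := by
  simp [cesaro, LinearMap.sum_apply]

lemma cesaro_mono (hP : P.Valid) (n : ℕ) {g h : P.State → ℝ} (hgh : ∀ x, g x ≤ h x) :
    P.cesaro n g ≤ P.cesaro n h := by
  rw [cesaro_apply, cesaro_apply]
  exact mul_le_mul_of_nonneg_left (Finset.sum_le_sum fun m _ => step_pow_mono hP hgh m 0)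
    (by positivity)

lemma cesaro_const {n : ℕ} (hn : n ≠ 0) (c : ℝ) : P.cesaro n (fun _ => c) = c := by
  have : (n : ℝ) ≠ 0 := by exact_mod_cast hn
  rw [cesaro_apply]
  simp only [step_pow_const, Finset.sum_const, Finset.card_range, nsmul_eq_mul]
  field_simp

/-- Since `gen = totalRate • (step - 1)`, the sum telescopes. -/
lemma cesaro_gen (hP : P.Valid) (n : ℕ) (g : P.State → ℝ) :
    P.cesaro n (P.gen g) = P.totalRate * ((n : ℝ)⁻¹ * ((P.step ^ n) g 0 - g 0)) := by
  have hgen : P.gen g = P.totalRate • (P.step g - g) := by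
    funext x
    have := (totalRate_pos hP).ne'
    simp only [Pi.smul_apply, Pi.sub_apply, step_apply, smul_eq_mul]
    field_simp
    ring
  rw [hgen, map_smul, smul_eq_mul, cesaro_apply]
  have hstep (m : ℕ) : (P.step ^ m) (P.step g - g) 0 = (P.step ^ (m + 1)) g 0 - (P.step ^ m) g 0 := by
    rw [map_sub, pow_succ]; rfl
  simp only [hstep, Finset.sum_range_sub (fun m => (P.step ^ m) g 0)]
  rfl

/-- Foster's criterion bounds the mean of `f`. -/
lemma cesaro_le_of_drift (hP : P.Valid) {V f : P.State → ℝ} {c : ℝ} (hV : ∀ x, 0 ≤ V x)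
    (hV0 : V 0 = 0) (hdrift : ∀ x, P.gen V x ≤ c - f x) {n : ℕ} (hn : n ≠ 0) :
    P.cesaro n f ≤ c := by
  -- No integrability is at stake: each `(P.step ^ m) g 0` is a finite combination of values of `g`,
  -- so `V` and `f` may be unbounded.
  have h1 : P.cesaro n f ≤ P.cesaro n ((fun _ => c) - P.gen V) :=
    cesaro_mono hP n fun x => by
      have := hdrift x
      simp only [Pi.sub_apply]
      linarith
  rw [map_sub, cesaro_const hn, cesaro_gen hP, hV0] at h1
  have h2 : 0 ≤ P.totalRate * ((n : ℝ)⁻¹ * ((P.step ^ n) V 0 - 0)) := by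
    have := step_pow_nonneg hP hV n 0
    have := (totalRate_pos hP).le
    rw [sub_zero]
    positivity
  linarith

lemma tendsto_cesaro_gen (hP : P.Valid) {g : P.State → ℝ} (hg0 : ∀ x, 0 ≤ g x)
    (hg1 : ∀ x, g x ≤ 1) : Tendsto (fun n => P.cesaro n (P.gen g)) atTop (𝓝 0) := by
  simp only [cesaro_gen hP]
  rw [← mul_zero P.totalRate]
  refine Tendsto.const_mul _ ?_
  refine (tendsto_inv_atTop_nhds_zero_nat (𝕜 := ℝ)).zero_mul_isBoundedUnder_le ?_
  refine isBoundedUnder_of ⟨1, fun n => ?_⟩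
  have h1 := step_pow_nonneg hP hg0 n 0
  have h2 := step_pow_mono hP hg1 n 0
  rw [step_pow_const] at h2
  have h3 := hg0 0
  have h4 := hg1 0
  simp only [Function.comp, Real.norm_eq_abs, abs_le]
  constructor <;> linarith

lemma point_nonneg (y x : P.State) : 0 ≤ point y x := by
  unfold point; split_ifs <;> norm_num

lemma point_le_one (y x : P.State) : point y x ≤ 1 := by
  unfold point; split_ifs <;> norm_num

lemma sum_smul_point_apply (S : Finset P.State) (a : P.State → ℝ) (x : P.State) :
    (∑ y ∈ S, a y • point y) x = if x ∈ S then a x else 0 := by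
  simp [Finset.sum_apply, point]

/-- One jump removes at most one job, so `y` is reached only from the finitely many states below `y
+ 1`. -/
lemma gen_point_eq_zero {x y : P.State} (hxy : ¬ x ≤ y + 1) : P.gen (point y) x = 0 := by
  have h0 : y ≠ x := by
    rintro rfl; exact hxy fun s => Nat.le_succ _
  have h1 (s) : y ≠ P.addJob x s := by
    rintro rfl
    refine hxy fun t => ?_
    by_cases h : t = s
    · subst h; simp [addJob]; omega
    · simp [addJob, h]
  have h2 (s) : y ≠ P.removeJob x s := by
    rintro rfl
    refine hxy fun t => ?_
    by_cases h : t = s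
    · subst h; simp [removeJob]; omega
    · simp [removeJob, h]
  simp [gen_apply, point, h0, h1, h2]

/-- **Foster's criterion**: a drift condition with a function whose sublevel sets are finite gives a
stationary probability distribution. -/
theorem stable_of_drift (hP : P.Valid) {V f : P.State → ℝ} {c : ℝ} (hV : ∀ x, 0 ≤ V x)
    (hV0 : V 0 = 0) (hf : ∀ x, 0 ≤ f x) (hfin : ∀ R, {x | f x ≤ R}.Finite)
    (hdrift : ∀ x, P.gen V x ≤ c - f x) : P.Stable := by
  -- Along a free ultrafilter all the bounded sequences `cesaro n (point y)` converge at once,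
  -- replacing a diagonal subsequence.
  have hatTop : (hyperfilter ℕ : Filter ℕ) ≤ atTop := Nat.hyperfilter_le_atTop
  have hne : ∀ᶠ n in (hyperfilter ℕ : Filter ℕ), n ≠ 0 := hatTop (eventually_ne_atTop 0)
  have hlim (y : P.State) : ∃ a, Tendsto (fun n => P.cesaro n (point y)) (hyperfilter ℕ) (𝓝 a) := by
    obtain ⟨a, -, ha⟩ := (isCompact_Icc (a := (0 : ℝ)) (b := 1)).ultrafilter_le_nhds'
      ((hyperfilter ℕ).map fun n => P.cesaro n (point y)) (by
        rw [Ultrafilter.mem_map]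
        filter_upwards [hne] with n hn
        constructor
        · exact (cesaro_const hn 0).symm.trans_le (cesaro_mono hP n (point_nonneg y))
        · exact (cesaro_mono hP n (point_le_one y)).trans_eq (cesaro_const hn 1))
    exact ⟨a, ha⟩
  choose p hp using hlim
  have hsum (S : Finset P.State) (a : P.State → ℝ) :
      Tendsto (fun n => P.cesaro n (∑ y ∈ S, a y • point y)) (hyperfilter ℕ)
        (𝓝 (∑ y ∈ S, a y * p y)) := by
    simp only [map_sum, map_smul, smul_eq_mul]
    exact tendsto_finsetSum _ fun y _ => (hp y).const_mul _
  have hp0 (y) : 0 ≤ p y := by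
    refine ge_of_tendsto (hp y) (hne.mono fun n hn => ?_)
    exact (cesaro_const hn 0).symm.trans_le (cesaro_mono hP n (point_nonneg y))
  refine ⟨p, hp0, hasSum_of_isLUB_of_nonneg _ hp0 ⟨?_, ?_⟩, fun y => ?_⟩
  · rintro _ ⟨S, rfl⟩
    have h := hsum S 1
    simp only [Pi.one_apply, one_mul] at h
    refine le_of_tendsto h (hne.mono fun n hn => ?_)
    refine (cesaro_mono hP n fun x => ?_).trans_eq (cesaro_const hn 1)
    have := sum_smul_point_apply S 1 x
    simp only [Pi.one_apply] at this
    rw [this]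
    split_ifs <;> norm_num
  · intro b hb
    -- Tightness by Markov's inequality: the indicator of `{f ≤ R}` is at least `1 - f / R`, and the
    -- mean of `f` is at most `c`. Hence no mass escapes in the limit.
    have hbound : ∀ R : ℝ, 0 < R → 1 - R⁻¹ * c ≤ b := by
      intro R hR
      refine le_trans ?_ (hb ⟨(hfin R).toFinset, rfl⟩)
      have h := hsum (hfin R).toFinset 1
      simp only [Pi.one_apply, one_mul] at h
      refine ge_of_tendsto h (hne.mono fun n hn => ?_)
      have h1 : P.cesaro n ((fun _ => 1) - R⁻¹ • f) ≤
          P.cesaro n (∑ y ∈ (hfin R).toFinset, (1 : ℝ) • point y) := by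
        refine cesaro_mono hP n fun x => ?_
        have := sum_smul_point_apply (hfin R).toFinset 1 x
        simp only [Pi.one_apply] at this
        rw [this]
        simp only [Pi.sub_apply, Pi.smul_apply, smul_eq_mul, Set.Finite.mem_toFinset,
          Set.mem_ofPred_eq]
        have hx := hf x
        split_ifs with hxR
        · have : 0 ≤ R⁻¹ * f x := by positivity
          linarith
        · have : 1 ≤ R⁻¹ * f x := by
            rw [inv_mul_eq_div, one_le_div hR]
            exact (not_le.1 hxR).le
          linarith
      rw [map_sub, map_smul, cesaro_const hn, smul_eq_mul] at h1
      have h2 := mul_le_mul_of_nonneg_left (cesaro_le_of_drift hP hV hV0 hdrift hn)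
        (inv_pos.2 hR).le
      linarith
    have hlim : Tendsto (fun R : ℝ => 1 - R⁻¹ * c) atTop (𝓝 1) := by
      have := (tendsto_inv_atTop_zero (𝕜 := ℝ)).mul_const c
      simpa using this.const_sub 1
    exact le_of_tendsto hlim ((eventually_gt_atTop 0).mono hbound)
  -- Balance at `y` is a finite sum, so it passes to the limit from `cesaro n (gen (point y)) → 0`.
  · have hzero : ∀ x ∉ Finset.Iic (y + 1), P.Q x y = 0 := fun x hx => by
      rw [Q_eq_gen_point]; exact gen_point_eq_zero (by simpa using hx)
    have hS := hasSum_sum_of_ne_finset_zero (L := SummationFilter.unconditional _)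
      (f := fun x => p x * P.Q x y) (s := Finset.Iic (y + 1)) fun x hx => by
        simp [hzero x hx]
    convert hS using 1
    have h := hsum (Finset.Iic (y + 1)) (fun x => P.Q x y)
    have hgen : ∑ x ∈ Finset.Iic (y + 1), P.Q x y • point x = P.gen (point y) := by
      funext x
      rw [sum_smul_point_apply _ (fun x => P.Q x y)]
      split_ifs with hx
      · rfl
      · exact (hzero x hx).symm
    rw [hgen] at h
    rw [tendsto_nhds_unique ((tendsto_cesaro_gen hP (point_nonneg y) (point_le_one y)).mono_left
      hatTop) h]
    exact Finset.sum_congr rfl fun x _ => mul_comm _ _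

/-! ### Quadratic drift and stability -/

lemma sum_update_sub (x : P.State) (s : P.Server) (v : ℕ) (F : P.Server → ℕ → ℝ) :
    ∑ t, F t (Function.update x s v t) - ∑ t, F t (x t) = F s v - F s (x s) := by
  rw [← Finset.sum_sub_distrib, Finset.sum_eq_single s]
  · simp
  · intro t _ hts
    simp [Function.update_of_ne hts]
  · simp

lemma sum_mu (P : Params) : ∑ s, P.mu s = P.muF * P.kF + P.muS * P.kS := by
  simp [Fintype.sum_sum_type, mu, mul_comm]

/-- A square grows by `2 x + 1` at an arrival and changes by `1 - 2 x` at a departure; the unit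
terms add up to at most `totalRate`. The inequality is due to empty servers, which have no
departures. -/
lemma gen_sum_sq_le (hP : P.Valid) (x : P.State) :
    P.gen (fun x => ∑ s, (x s : ℝ) ^ 2) x ≤
      2 * (P.lam * ((P.kF : ℝ) + P.kS)) * ∑ s, P.routeProb x s * (x s : ℝ) + P.totalRate -
        2 * ∑ s, P.mu s * (x s : ℝ) := by
  have hadd (s) : ∑ t, ((P.addJob x s t : ℕ) : ℝ) ^ 2 - ∑ t, (x t : ℝ) ^ 2 = 2 * x s + 1 := by
    rw [addJob, sum_update_sub x s (x s + 1) (fun _ v => (v : ℝ) ^ 2)]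
    push_cast
    ring
  have hrem (s) (hs : 0 < x s) :
      ∑ t, ((P.removeJob x s t : ℕ) : ℝ) ^ 2 - ∑ t, (x t : ℝ) ^ 2 = 1 - 2 * x s := by
    rw [removeJob, sum_update_sub x s (x s - 1) (fun _ v => (v : ℝ) ^ 2), Nat.cast_sub hs]
    push_cast
    ring
  have h1 : ∑ s, P.arrivalRate x s *
      (∑ t, ((P.addJob x s t : ℕ) : ℝ) ^ 2 - ∑ t, (x t : ℝ) ^ 2) =
      2 * (P.lam * ((P.kF : ℝ) + P.kS)) * ∑ s, P.routeProb x s * (x s : ℝ) +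
        P.lam * ((P.kF : ℝ) + P.kS) := by
    rw [← sum_arrivalRate hP x, Finset.mul_sum, ← Finset.sum_add_distrib]
    refine Finset.sum_congr rfl fun s _ => ?_
    rw [hadd, sum_arrivalRate hP, arrivalRate]
    ring
  have h2 : (∑ s, if 0 < x s then P.mu s *
      (∑ t, ((P.removeJob x s t : ℕ) : ℝ) ^ 2 - ∑ t, (x t : ℝ) ^ 2) else 0) ≤
      ∑ s, P.mu s - 2 * ∑ s, P.mu s * (x s : ℝ) := by
    rw [Finset.mul_sum, ← Finset.sum_sub_distrib]
    refine Finset.sum_le_sum fun s _ => ?_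
    have hmu := mu_pos hP s
    split_ifs with hs
    · rw [hrem s hs]
      linarith
    · have : x s = 0 := by omega
      simp [this, hmu.le]
  rw [gen_apply, totalRate]
  linarith

/-- Stability when, with all servers busy, each class receives work in proportion to its capacity. -/
theorem stable_of_balanced (hP : P.Valid) (hF : P.pF * ((P.kF : ℝ) + P.kS) = P.muF * P.kF)
    (hS : (1 - P.pF) * ((P.kF : ℝ) + P.kS) = P.muS * P.kS) (hpS : 1 - P.pS ≤ P.pF)
    (hlam : P.lam < 1) : P.Stable := by
  have hl : 0 < 1 - P.lam := sub_pos.2 hlam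
  have hlam0 := hP.lam_pos
  have hK := servers_pos hP
  refine stable_of_drift hP (V := fun x => ∑ s, (x s : ℝ) ^ 2)
    (f := fun x => 2 * (1 - P.lam) * ∑ s, P.mu s * (x s : ℝ))
    (c := P.totalRate) (fun x => by positivity) (by simp) (fun x => ?_) (fun R => ?_) (fun x => ?_)
  · have : 0 ≤ ∑ s, P.mu s * (x s : ℝ) :=
      Finset.sum_nonneg fun s _ => mul_nonneg (mu_pos hP s).le (Nat.cast_nonneg _)
    positivity
  -- Each `mu s * x s` is at most the whole sum, so a sublevel set lies in a box.
  · refine (Set.finite_Iic (fun s => ⌊R / (2 * (1 - P.lam) * P.mu s)⌋₊ : P.State)).subset ?_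
    intro x hx s
    have hmu := mu_pos hP s
    refine Nat.le_floor ?_
    rw [le_div_iff₀ (by positivity)]
    have h1 : P.mu s * (x s : ℝ) ≤ ∑ s, P.mu s * (x s : ℝ) :=
      Finset.single_le_sum (f := fun s => P.mu s * (x s : ℝ))
        (fun s _ => mul_nonneg (mu_pos hP s).le (Nat.cast_nonneg _)) (Finset.mem_univ s)
    have h2 := mul_le_mul_of_nonneg_left h1 (by positivity : 0 ≤ 2 * (1 - P.lam))
    have h3 : 2 * (1 - P.lam) * ∑ s, P.mu s * (x s : ℝ) ≤ R := hx
    linarith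
  · have h1 := mul_le_mul_of_nonneg_left (sum_routeProb_mul_le hP hpS x)
      (by positivity : 0 ≤ 2 * (P.lam * ((P.kF : ℝ) + P.kS)))
    have hkF : (P.kF : ℝ) ≠ 0 := by
      have := hP.one_le_dF.trans hP.dF_le
      positivity
    have hkS : (P.kS : ℝ) ≠ 0 := by
      have := hP.one_le_dS.trans hP.dS_le
      positivity
    have h2 : 2 * (P.lam * ((P.kF : ℝ) + P.kS)) *
        (P.pF * ((∑ i, (x (Sum.inl i) : ℝ)) / P.kF) +
          (1 - P.pF) * ((∑ j, (x (Sum.inr j) : ℝ)) / P.kS)) =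
        2 * P.lam * ∑ s, P.mu s * (x s : ℝ) := by
      rw [Fintype.sum_sum_type]
      simp only [mu, ← Finset.mul_sum]
      -- The balance hypotheses say that, with all servers busy and `lam = 1`, each class gets per
      -- server its own service rate.
      have e1 : P.muF = P.pF * ((P.kF : ℝ) + P.kS) / P.kF := by rw [hF]; field_simp
      have e2 : P.muS = (1 - P.pF) * ((P.kF : ℝ) + P.kS) / P.kS := by rw [hS]; field_simp
      rw [e1, e2]
      ring
    have h3 := gen_sum_sq_le hP x
    rw [h2] at h1
    linarith

/-! ### Stationary flow balance and instability -/

lemma abs_gen_le (hP : P.Valid) {g : P.State → ℝ} {b : ℝ} (hb : 0 ≤ b)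
    (hadd : ∀ x s, |g (P.addJob x s) - g x| ≤ b)
    (hrem : ∀ x s, |g (P.removeJob x s) - g x| ≤ b) (x : P.State) :
    |P.gen g x| ≤ P.totalRate * b := by
  rw [gen_apply, totalRate, add_mul, ← sum_arrivalRate hP x, Finset.sum_mul, Finset.sum_mul]
  refine (abs_add_le _ _).trans (add_le_add ?_ ?_)
  · refine (Finset.abs_sum_le_sum_abs _ _).trans (Finset.sum_le_sum fun s _ => ?_)
    have h := arrivalRate_nonneg hP x s
    rw [abs_mul, abs_of_nonneg h]
    exact mul_le_mul_of_nonneg_left (hadd x s) h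
  · refine (Finset.abs_sum_le_sum_abs _ _).trans (Finset.sum_le_sum fun s _ => ?_)
    have h := (mu_pos hP s).le
    split_ifs
    · rw [abs_mul, abs_of_nonneg h]
      exact mul_le_mul_of_nonneg_left (hrem x s) h
    · rw [abs_zero]; positivity

lemma tendsto_gen {ι : Type*} {l : Filter ι} {G : ι → P.State → ℝ} {g : P.State → ℝ}
    (h : ∀ x, Tendsto (fun i => G i x) l (𝓝 (g x))) (x : P.State) :
    Tendsto (fun i => P.gen (G i) x) l (𝓝 (P.gen g x)) := by
  simp only [gen_apply]
  refine (tendsto_finsetSum _ fun s _ => ((h _).sub (h _)).const_mul _).add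
    (tendsto_finsetSum _ fun s _ => ?_)
  split_ifs
  · exact ((h _).sub (h _)).const_mul _
  · exact tendsto_const_nhds

/-- The test functions whose generator integrates to zero are closed under pointwise limits with
uniformly bounded increments. -/
lemma hasSum_gen_of_tendsto (hP : P.Valid) {p : P.State → ℝ} (hp : P.IsStationary p) {ι : Type*}
    {l : Filter ι} [l.NeBot] {G : ι → P.State → ℝ} {g : P.State → ℝ} {b : ℝ} (hb : 0 ≤ b)
    (hG : ∀ i, HasSum (fun x => p x * P.gen (G i) x) 0)
    (hadd : ∀ i x s, |G i (P.addJob x s) - G i x| ≤ b)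
    (hrem : ∀ i x s, |G i (P.removeJob x s) - G i x| ≤ b)
    (h : ∀ x, Tendsto (fun i => G i x) l (𝓝 (g x))) :
    HasSum (fun x => p x * P.gen g x) 0 := by
  have hbound : Summable fun x => p x * (P.totalRate * b) := hp.2.1.summable.mul_right _
  have hle (i) (x) : ‖p x * P.gen (G i) x‖ ≤ p x * (P.totalRate * b) := by
    rw [Real.norm_eq_abs, abs_mul, abs_of_nonneg (hp.1 x)]
    exact mul_le_mul_of_nonneg_left (abs_gen_le hP hb (hadd i) (hrem i) x) (hp.1 x)
  have hlim (x) : Tendsto (fun i => p x * P.gen (G i) x) l (𝓝 (p x * P.gen g x)) :=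
    (tendsto_gen h x).const_mul _
  have ht := tendsto_tsum_of_dominated_convergence hbound hlim (Eventually.of_forall hle)
  simp only [(hG _).tsum_eq] at ht
  have hsum : Summable fun x => p x * P.gen g x :=
    Summable.of_norm_bounded hbound fun x =>
      le_of_tendsto (hlim x).norm (Eventually.of_forall fun i => hle i x)
  rw [tendsto_nhds_unique tendsto_const_nhds ht]
  exact hsum.hasSum

/-- Stationarity gives the claim for `point y`, hence for finite combinations. The restrictions of
`g` to finite sets have values in `[0, b]`, so their increments are bounded by `b` and the limit
over finite sets applies. -/
lemma hasSum_gen_of_bounded (hP : P.Valid) {p : P.State → ℝ} (hp : P.IsStationary p)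
    {g : P.State → ℝ} {b : ℝ} (hg0 : ∀ x, 0 ≤ g x) (hgb : ∀ x, g x ≤ b) :
    HasSum (fun x => p x * P.gen g x) 0 := by
  have hb : 0 ≤ b := (hg0 0).trans (hgb 0)
  have hG0 (S : Finset P.State) (x) : 0 ≤ (∑ y ∈ S, g y • point y) x := by
    rw [sum_smul_point_apply]
    split_ifs
    · exact hg0 x
    · exact le_rfl
  have hGb (S : Finset P.State) (x) : (∑ y ∈ S, g y • point y) x ≤ b := by
    rw [sum_smul_point_apply]
    split_ifs
    · exact hgb x
    · exact hb
  have hdiff (S : Finset P.State) (x y : P.State) :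
      |(∑ y ∈ S, g y • point y) x - (∑ y ∈ S, g y • point y) y| ≤ b := by
    rw [abs_le]
    constructor <;> linarith [hG0 S x, hG0 S y, hGb S x, hGb S y]
  refine hasSum_gen_of_tendsto hP hp (l := atTop) (b := b)
    (G := fun S : Finset P.State => ∑ y ∈ S, g y • point y) hb (fun S => ?_)
    (fun S x s => hdiff S _ _) (fun S x s => hdiff S _ _) (fun x => ?_)
  · have h := hasSum_sum (s := S) fun y _ => (hp.2.2 y).mul_left (g y)
    simp only [mul_zero, Finset.sum_const_zero] at h
    refine (funext fun x => ?_ : (fun x => p x * P.gen (∑ y ∈ S, g y • point y) x) = _) ▸ h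
    rw [map_sum, Finset.sum_apply, Finset.mul_sum]
    refine Finset.sum_congr rfl fun y _ => ?_
    rw [map_smul, Pi.smul_apply, smul_eq_mul, Q_eq_gen_point]
    ring
  · refine tendsto_const_nhds.congr' ?_
    filter_upwards [eventually_ge_atTop {x}] with S hS
    rw [sum_smul_point_apply, if_pos (hS (Finset.mem_singleton_self x))]

/-- Flow balance: in stationarity, jobs arrive at a weighted class of servers as fast as they
leave it. -/
lemma hasSum_flow (hP : P.Valid) {p : P.State → ℝ} (hp : P.IsStationary p) {w : P.Server → ℝ}
    (hw0 : ∀ s, 0 ≤ w s) (hw1 : ∀ s, w s ≤ 1) :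
    HasSum (fun x => p x * ((∑ s, w s * P.arrivalRate x s) -
      ∑ s, if 0 < x s then w s * P.mu s else 0)) 0 := by
  set W : P.State → ℝ := fun x => ∑ s, w s * (x s : ℝ) with hW
  have hadd (x s) : W (P.addJob x s) - W x = w s := by
    rw [hW, addJob]
    simp only []
    rw [sum_update_sub x s (x s + 1) (fun s v => w s * (v : ℝ))]
    push_cast
    ring
  have hrem (x : P.State) (s) (hs : 0 < x s) : W (P.removeJob x s) - W x = - w s := by
    rw [hW, removeJob]
    simp only []
    rw [sum_update_sub x s (x s - 1) (fun s v => w s * (v : ℝ)), Nat.cast_sub hs]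
    push_cast
    ring
  have hrem' (x : P.State) (s) : |W (P.removeJob x s) - W x| ≤ 1 := by
    rcases Nat.eq_zero_or_pos (x s) with hs | hs
    -- At an empty server, truncated subtraction makes `removeJob` the identity.
    · have : P.removeJob x s = x := by
        rw [removeJob, hs, Nat.zero_sub, ← hs, Function.update_eq_self]
      simp [this]
    · rw [hrem x s hs, abs_neg, abs_of_nonneg (hw0 s)]
      exact hw1 s
  have hW0 (x) : 0 ≤ W x := Finset.sum_nonneg fun s _ => mul_nonneg (hw0 s) (Nat.cast_nonneg _)
  have hmin (a b c : ℝ) : |min a c - min b c| ≤ |a - b| := by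
    have := abs_min_sub_min_le_max a c b c
    simpa using this
  -- `W` may have infinite stationary mean, so it is truncated to `min W M`; truncation does not
  -- enlarge increments, which stay at most 1 as `M → ∞`.
  have h := hasSum_gen_of_tendsto hP hp (l := atTop) (b := 1) (g := W)
    (G := fun (M : ℕ) x => min (W x) M) zero_le_one
    (fun M => hasSum_gen_of_bounded hP hp (b := M) (fun x => le_min (hW0 x) (Nat.cast_nonneg _))
      (fun x => min_le_right _ _))
    (fun M x s => (hmin _ _ _).trans (by
      rw [hadd, abs_of_nonneg (hw0 s)]; exact hw1 s))
    (fun M x s => (hmin _ _ _).trans (hrem' x s))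
    (fun x => by
      refine tendsto_const_nhds.congr' ?_
      filter_upwards [eventually_ge_atTop ⌈W x⌉₊] with M hM
      exact (min_eq_left ((Nat.le_ceil _).trans (by exact_mod_cast hM))).symm)
  convert h using 3 with x
  rw [gen_apply, sub_eq_add_neg, ← Finset.sum_neg_distrib]
  refine congrArg₂ (· + ·) (Finset.sum_congr rfl fun s _ => ?_)
    (Finset.sum_congr rfl fun s _ => ?_)
  · rw [hadd]; ring
  · split_ifs with hs
    · rw [hrem x s hs]; ring
    · simp

/-- At capacity `∑ mu = kF + kS`, the servers are idle a proportion `1 - lam` of the time, weighted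
by service rate. -/
lemma hasSum_idle (hP : P.Valid) (hcap : ∑ s, P.mu s = (P.kF : ℝ) + P.kS) {p : P.State → ℝ}
    (hp : P.IsStationary p) :
    HasSum (fun x => p x * ∑ s, if 0 < x s then 0 else P.mu s)
      ((1 - P.lam) * ((P.kF : ℝ) + P.kS)) := by
  have h := (hasSum_flow hP hp (w := fun _ => 1) (fun _ => zero_le_one) (fun _ => le_rfl)).add
    (hp.2.1.mul_right ((1 - P.lam) * ((P.kF : ℝ) + P.kS)))
  rw [zero_add, one_mul] at h
  refine (funext fun x => ?_ : (fun x => p x * ∑ s, if 0 < x s then 0 else P.mu s) = _) ▸ h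
  have hx : (∑ s, if 0 < x s then P.mu s else 0) + (∑ s, if 0 < x s then 0 else P.mu s) =
      (P.kF : ℝ) + P.kS := by
    rw [← hcap, ← Finset.sum_add_distrib]
    refine Finset.sum_congr rfl fun s _ => ?_
    split_ifs <;> ring
  simp only [one_mul]
  rw [sum_arrivalRate hP, ← mul_add]
  congr 1
  linarith

/-- A class that receives the share `c` of the jobs when all servers are busy must be able to serve
nearly the share `c` of all jobs. -/
lemma le_capacity_of_stationary (hP : P.Valid) (hmu : P.muS ≤ P.muF)
    (hcap : ∑ s, P.mu s = (P.kF : ℝ) + P.kS) {p : P.State → ℝ} (hp : P.IsStationary p)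
    {w : P.Server → ℝ} (hw0 : ∀ s, 0 ≤ w s) (hw1 : ∀ s, w s ≤ 1) {c : ℝ} (hc0 : 0 ≤ c)
    (hc : ∀ x : P.State, (∀ s, 0 < x s) → ∑ s, w s * P.routeProb x s = c) :
    P.lam * ((P.kF : ℝ) + P.kS) * c * (1 - (1 - P.lam) * ((P.kF : ℝ) + P.kS) / P.muS) ≤
      ∑ s, w s * P.mu s := by
  set K : ℝ := (P.kF : ℝ) + P.kS
  have hK : 0 < K := servers_pos hP
  have hlam := hP.lam_pos
  have hmuS := hP.muS_pos
  have hmu' : ∀ s, P.muS ≤ P.mu s := fun s => by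
    cases s
    · exact hmu
    · exact le_rfl
  -- Pointwise form of the bound on the probability of an idle server. If all are busy, the class
  -- receives exactly `lam * K * c`; otherwise the idle capacity is at least `muS`, and the
  -- subtracted term cancels all of `lam * K * c`.
  have hle : ∀ x : P.State, p x * (P.lam * K * c - ∑ s, w s * P.mu s) -
      P.lam * K * c / P.muS * (p x * ∑ s, if 0 < x s then 0 else P.mu s) ≤
      p x * ((∑ s, w s * P.arrivalRate x s) - ∑ s, if 0 < x s then w s * P.mu s else 0) := by
    intro x
    have h1 : (∑ s, if 0 < x s then w s * P.mu s else 0) ≤ ∑ s, w s * P.mu s := by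
      refine Finset.sum_le_sum fun s _ => ?_
      split_ifs
      · exact le_rfl
      · exact mul_nonneg (hw0 s) (mu_pos hP s).le
    have h2 : P.lam * K * c - P.lam * K * c / P.muS * (∑ s, if 0 < x s then 0 else P.mu s) ≤
        ∑ s, w s * P.arrivalRate x s := by
      have hidle (s) : 0 ≤ if 0 < x s then 0 else P.mu s := by
        split_ifs
        · exact le_rfl
        · exact (mu_pos hP s).le
      by_cases hx : ∀ s, 0 < x s
      · have : ∑ s, w s * P.arrivalRate x s = P.lam * K * c := by
          rw [← hc x hx, Finset.mul_sum]
          refine Finset.sum_congr rfl fun s _ => ?_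
          rw [arrivalRate]
          ring
        rw [this]
        have h3 := Finset.sum_nonneg fun s (_ : s ∈ Finset.univ) => hidle s
        have : 0 ≤ P.lam * K * c / P.muS * ∑ s, if 0 < x s then 0 else P.mu s := by positivity
        linarith
      · have h3 : 0 ≤ ∑ s, w s * P.arrivalRate x s :=
          Finset.sum_nonneg fun s _ => mul_nonneg (hw0 s) (arrivalRate_nonneg hP x s)
        push Not at hx
        obtain ⟨s, hs⟩ := hx
        have h4 : P.muS ≤ ∑ s, if 0 < x s then 0 else P.mu s := by
          refine le_trans ?_ (Finset.single_le_sum (fun s _ => hidle s) (Finset.mem_univ s))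
          rw [if_neg (by omega)]
          exact hmu' s
        have h5 := mul_le_mul_of_nonneg_left h4 (by positivity : 0 ≤ P.lam * K * c / P.muS)
        rw [div_mul_cancel₀ _ hmuS.ne'] at h5
        linarith
    have h3 := mul_le_mul_of_nonneg_left (sub_le_sub h2 h1) (hp.1 x)
    linarith
  have h := hasSum_le hle ((hp.2.1.mul_right _).sub ((hasSum_idle hP hcap hp).mul_left _))
    (hasSum_flow hP hp hw0 hw1)
  have e : P.lam * K * c * (1 - (1 - P.lam) * K / P.muS) =
    P.lam * K * c - P.lam * K * c / P.muS * ((1 - P.lam) * K) := by ring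
  rw [e]
  linarith

lemma capacity_fast_of_stable (hP : P.Valid) (hmu : P.muS ≤ P.muF)
    (hcap : ∑ s, P.mu s = (P.kF : ℝ) + P.kS) (h : P.Stable) :
    P.lam * ((P.kF : ℝ) + P.kS) * P.pF * (1 - (1 - P.lam) * ((P.kF : ℝ) + P.kS) / P.muS) ≤
      P.muF * P.kF := by
  obtain ⟨p, hp⟩ := h
  refine (le_capacity_of_stationary hP hmu hcap hp (w := Sum.elim (fun _ => 1) (fun _ => 0))
    ?_ ?_ hP.pF_nonneg ?_).trans_eq ?_
  · rintro (_ | _) <;> simp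
  · rintro (_ | _) <;> simp
  · intro x hx
    simpa [Fintype.sum_sum_type] using sum_routeProb_inl hP hx
  · simp [Fintype.sum_sum_type, mu, mul_comm]

lemma capacity_slow_of_stable (hP : P.Valid) (hmu : P.muS ≤ P.muF)
    (hcap : ∑ s, P.mu s = (P.kF : ℝ) + P.kS) (h : P.Stable) :
    P.lam * ((P.kF : ℝ) + P.kS) * (1 - P.pF) *
      (1 - (1 - P.lam) * ((P.kF : ℝ) + P.kS) / P.muS) ≤ P.muS * P.kS := by
  obtain ⟨p, hp⟩ := h
  refine (le_capacity_of_stationary hP hmu hcap hp (w := Sum.elim (fun _ => 0) (fun _ => 1))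
    ?_ ?_ (sub_nonneg.2 hP.pF_le_one) ?_).trans_eq ?_
  · rintro (_ | _) <;> simp
  · rintro (_ | _) <;> simp
  · intro x hx
    simpa [Fintype.sum_sum_type] using sum_routeProb_inr hP hx
  · simp [Fintype.sum_sum_type, mu, mul_comm]

end Params

/-! ### Loads near capacity and the theorem -/

/-- Strict overload of a class at full load persists for loads close to `1`. -/
lemma eventually_lt_mul {K c m r : ℝ} (h : m < K * c) :
    ∀ᶠ lam : ℝ in 𝓝[<] 1, m < lam * K * c * (1 - (1 - lam) * K / r) := by
  have hcont : Continuous fun lam : ℝ => lam * K * c * (1 - (1 - lam) * K / r) := by fun_prop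
  have ht := hcont.tendsto 1
  simp only [one_mul, sub_self, zero_mul, zero_div, sub_zero, mul_one] at ht
  exact (ht.eventually_const_lt h).filter_mono nhdsWithin_le_nhds

end Dispatch

theorem theorem2 (policy : Dispatch.Policy) (kF kS dF dS : ℕ)
    (hdF : 1 ≤ dF) (hdFk : dF ≤ kF) (hdS : 1 ≤ dS) (hdSk : dS ≤ kS)
    (muF muS qF qS : ℝ) (hmuS : 0 < muS) (hmuF : muS < muF)
    (hqF : qF = (kF : ℝ) / ((kF : ℝ) + (kS : ℝ)))
    (hqS : qS = (kS : ℝ) / ((kF : ℝ) + (kS : ℝ)))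
    (hcap : muF * qF + muS * qS = 1)
    (pF : ℝ) (hpF0 : 0 ≤ pF) (hpF1 : pF ≤ 1) :
    -- stability, for every load below capacity
    (pF = muF * qF → ∀ pS : ℝ, muS * qS ≤ pS → pS ≤ 1 →
      ∀ lam : ℝ, 0 < lam → lam < 1 →
        Dispatch.Params.Stable ⟨policy, kF, kS, dF, dS, muF, muS, pF, pS, lam⟩) ∧
    -- instability, for every load close enough to capacity and every choice of `pS`
    (pF ≠ muF * qF → ∀ᶠ lam : ℝ in 𝓝[<] 1, ∀ pS : ℝ, 0 ≤ pS → pS ≤ 1 →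
        ¬ Dispatch.Params.Stable ⟨policy, kF, kS, dF, dS, muF, muS, pF, pS, lam⟩) ∧
    -- the only choice of `pF` that is stable as the load approaches capacity
    ((∃ pS : ℝ, 0 ≤ pS ∧ pS ≤ 1 ∧ ∀ᶠ lam : ℝ in 𝓝[<] 1,
        Dispatch.Params.Stable ⟨policy, kF, kS, dF, dS, muF, muS, pF, pS, lam⟩) ↔
      pF = muF * qF) := by

  have hkF : (0 : ℝ) < kF := by exact_mod_cast hdF.trans hdFk
  have hkS : (0 : ℝ) < kS := by exact_mod_cast hdS.trans hdSk
  have hK : (0 : ℝ) < (kF : ℝ) + kS := by positivity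
  have hmuF0 : 0 < muF := hmuS.trans hmuF
  have hF : muF * qF * ((kF : ℝ) + kS) = muF * kF := by rw [hqF]; field_simp
  have hS : muS * qS * ((kF : ℝ) + kS) = muS * kS := by rw [hqS]; field_simp
  have hFpos : 0 < muF * qF := by rw [hqF]; positivity
  have hSpos : 0 < muS * qS := by rw [hqS]; positivity
  have hsum : muF * kF + muS * kS = (kF : ℝ) + kS := by
    rw [← hF, ← hS, ← add_mul, hcap, one_mul]
  have hvalid : ∀ pS lam : ℝ, 0 ≤ pS → pS ≤ 1 → 0 < lam →
      Dispatch.Params.Valid ⟨policy, kF, kS, dF, dS, muF, muS, pF, pS, lam⟩ :=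
    fun pS lam h0 h1 hl => ⟨hdF, hdFk, hdS, hdSk, hmuF0, hmuS, hpF0, hpF1, h0, h1, hl⟩
  have hstable : pF = muF * qF → ∀ pS : ℝ, muS * qS ≤ pS → pS ≤ 1 →
      ∀ lam : ℝ, 0 < lam → lam < 1 →
        Dispatch.Params.Stable ⟨policy, kF, kS, dF, dS, muF, muS, pF, pS, lam⟩ := by
    intro hpF pS hpS hpS1 lam hl hl1
    have hpF' : 1 - pF = muS * qS := by linarith
    refine Dispatch.Params.stable_of_balanced (hvalid pS lam (hSpos.le.trans hpS) hpS1 hl)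
      ?_ ?_ ?_ hl1
    · simpa only [hpF] using hF
    · simpa only [hpF'] using hS
    · change 1 - pS ≤ pF
      linarith
  have hunstable : pF ≠ muF * qF → ∀ᶠ lam : ℝ in 𝓝[<] 1, ∀ pS : ℝ, 0 ≤ pS → pS ≤ 1 →
      ¬ Dispatch.Params.Stable ⟨policy, kF, kS, dF, dS, muF, muS, pF, pS, lam⟩ := by
    intro hne
    have hpos : ∀ᶠ lam : ℝ in 𝓝[<] 1, 0 < lam :=
      nhdsWithin_le_nhds (lt_mem_nhds zero_lt_one)
    -- Too small a `pF` overloads the slow class, too large a `pF` the fast class.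
    rcases lt_or_gt_of_ne hne with hlt | hgt
    · have hover : muS * kS < ((kF : ℝ) + kS) * (1 - pF) := by
        rw [← hS, mul_comm]
        exact mul_lt_mul_of_pos_left (by linarith) hK
      filter_upwards [hpos, Dispatch.eventually_lt_mul (r := muS) hover] with lam hl hlt pS h0 h1 hst
      exact hlt.not_ge (Dispatch.Params.capacity_slow_of_stable (hvalid pS lam h0 h1 hl) hmuF.le
        ((Dispatch.Params.sum_mu _).trans hsum) hst)
    · have hover : muF * kF < ((kF : ℝ) + kS) * pF := by
        rw [← hF, mul_comm]
        exact mul_lt_mul_of_pos_left hgt hK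
      filter_upwards [hpos, Dispatch.eventually_lt_mul (r := muS) hover] with lam hl hlt pS h0 h1 hst
      exact hlt.not_ge (Dispatch.Params.capacity_fast_of_stable (hvalid pS lam h0 h1 hl) hmuF.le
        ((Dispatch.Params.sum_mu _).trans hsum) hst)
  -- The witness `pS = 1` satisfies `muS * qS ≤ pS` because `muF * qF > 0`.
  refine ⟨hstable, hunstable, ?_, fun hpF => ⟨1, zero_le_one, le_rfl, ?_⟩⟩
  · rintro ⟨pS, h0, h1, hst⟩
    by_contra hne
    -- Both properties hold for loads just below 1, so some load would be stable and unstable.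
    obtain ⟨lam, hl, hl'⟩ := (hst.and (hunstable hne)).exists
    exact hl' pS h0 h1 hl
  · filter_upwards [nhdsWithin_le_nhds (lt_mem_nhds zero_lt_one), self_mem_nhdsWithin]
      with lam hl hl1
    exact hstable hpF 1 (by linarith) le_rfl lam hl hl1
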